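/- Let $G$ be a powerful $2$-group, that is, a finite $2$-group such that $[G,G]\le G^4$, where $G^4$ is the subgroup generated by the fourth powers of the elements of $G$. For every integer $i\ge 0$, let $\Omega_i(G)$ be the subgroup of $G$ generated by all elements of $G$ of order at most $2^i$, and let $\exp H$ denote the exponent of a finite group $H$. Then, for every $i\ge 0$: (i) $\exp\,[\Omega_i(G),G]\le 2^i$; (ii) $\exp\,\Omega_i(G)\le 2^{i+1}$. -/

import Mathlib

/-- `powerSubgroup G n` is the subgroup `G ^ n` generated by all `n`-th powers of elements of `G`. -/
def powerSubgroup (G : Type*) [Group G] (n : ℕ) : Subgroup G :=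
  Subgroup.closure {x : G | ∃ g : G, x = g ^ n}

/-- The set of elements of `G` whose order is (finite and) at most `p ^ i`. -/
def omegaSet (p : ℕ) (G : Type*) [Group G] (i : ℕ) : Set G :=
  {x : G | IsOfFinOrder x ∧ orderOf x ≤ p ^ i}

/-- The omega subgroup: the subgroup generated by the elements of order at most `p ^ i`. -/
def omega (p : ℕ) (G : Type*) [Group G] (i : ℕ) : Subgroup G :=
  Subgroup.closure (omegaSet p G i)

/-- Powerful `p`-groups: finite `p`-groups `G` with `[G, G] ≤ G ^ p` if `p` is odd,
and with `[G, G] ≤ G ^ 4` if `p = 2`. -/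
structure IsPowerfulPGroup (p : ℕ) (G : Type*) [Group G] : Prop where
  finite : Finite G
  isPGroup : IsPGroup p G
  commutator_le : commutator G ≤ powerSubgroup G (if p = 2 then 4 else p)

open scoped commutatorElement

/-! Write Gₖ for `squareSeries G k`. Powerfulness gives [Gₖ, G] ≤ Gₖ₊₂, and every element of Gₖ₊₁ is
the square of one in Gₖ. Taking square roots in [x², g] = [x, [x, g]][x, g]² bounds orders of
commutators, by descending induction on the depth m (`omegaControl_of_succ`). At m = 0, the x in G₁
with x ^ 2 ^ i = 1 form a normal subgroup T, and [y, g] lies in T whenever y ^ 2 ^ i = 1. So Ωᵢ(G)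
is central modulo T, which is (i); its squares then multiply modulo T, so they lie in T, which is
(ii). -/

/-- The series `G = G₀ ≥ G₁ ≥ ⋯` in which `Gₖ₊₁` is generated by the squares of `Gₖ`. -/
def squareSeries (G : Type*) [Group G] : ℕ → Subgroup G
  | 0 => ⊤
  | k + 1 => Subgroup.closure {x : G | ∃ g ∈ squareSeries G k, x = g ^ 2}

section SquareSeries

variable {G : Type*} [Group G]

theorem sq_mem_squareSeries {k : ℕ} {x : G} (hx : x ∈ squareSeries G k) :
    x ^ 2 ∈ squareSeries G (k + 1) :=
  Subgroup.subset_closure ⟨x, hx, rfl⟩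

theorem squareSeries_succ_le_iff {k : ℕ} {H : Subgroup G} :
    squareSeries G (k + 1) ≤ H ↔ ∀ x ∈ squareSeries G k, x ^ 2 ∈ H := by
  refine ⟨fun h x hx => h (sq_mem_squareSeries hx), fun h => ?_⟩
  refine (Subgroup.closure_le H).2 ?_
  rintro _ ⟨x, hx, rfl⟩
  exact h x hx

theorem squareSeries_antitone : Antitone (squareSeries G) :=
  antitone_nat_of_succ_le fun _ => squareSeries_succ_le_iff.2 fun _ hx => pow_mem hx 2

instance squareSeries_normal (k : ℕ) : (squareSeries G k).Normal := by
  induction k with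
  | zero => exact (inferInstance : (⊤ : Subgroup G).Normal)
  | succ k ih =>
    refine ⟨fun x hx g => ?_⟩
    have : squareSeries G (k + 1) ≤ (squareSeries G (k + 1)).comap (MulAut.conj g).toMonoidHom :=
      squareSeries_succ_le_iff.2 fun y hy => by
        simpa [← conj_pow] using sq_mem_squareSeries (ih.conj_mem y hy g)
    exact this hx

theorem commutatorElement_sq_left (x g : G) : ⁅x ^ 2, g⁆ = ⁅x, ⁅x, g⁆⁆ * ⁅x, g⁆ ^ 2 := by
  simp only [commutatorElement_def, pow_two]
  group

theorem mul_sq_eq_conj_commutatorElement (x y : G) :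
    (x * y) ^ 2 = x * ⁅y, x⁆ * x⁻¹ * (x ^ 2 * y ^ 2) := by
  simp only [commutatorElement_def, pow_two]
  group

/-- If the commutators of the generators of a subgroup with `G` lie in a normal subgroup, so do
all commutators. -/
theorem commutatorElement_mem_of_mem_closure {M : Subgroup G} [M.Normal] {s : Set G}
    (h : ∀ x ∈ s, ∀ g : G, ⁅x, g⁆ ∈ M) {z : G} (hz : z ∈ Subgroup.closure s) (g : G) :
    ⁅z, g⁆ ∈ M := by
  have key : ∀ z g : G, ⁅z, g⁆ ∈ M ↔ Commute (z : G ⧸ M) (g : G ⧸ M) := by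
    intro z g
    rw [← commutatorElement_eq_one_iff_commute, ← QuotientGroup.eq_one_iff]
    rfl
  have : z ∈ (Subgroup.centralizer (Set.univ : Set (G ⧸ M))).comap (QuotientGroup.mk' M) := by
    refine (Subgroup.closure_le _).2 ?_ hz
    intro x hx
    simp only [SetLike.mem_coe, Subgroup.mem_comap, Subgroup.mem_centralizer_iff]
    rintro g -
    obtain ⟨g, rfl⟩ := QuotientGroup.mk_surjective g
    exact ((key x g).1 (h x hx g)).symm
  rw [key]
  exact ((Subgroup.mem_centralizer_iff.1 (Subgroup.mem_comap.1 this)) g trivial).symm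

/-- To prove A ≤ B one may enlarge B until A is central modulo it: with R = B γₙ₊₁, this pushes A
down the lower central series. -/
theorem le_of_forall_normal_commutator_le [Group.IsNilpotent G] {A B : Subgroup G} [B.Normal]
    (h : ∀ R : Subgroup G, R.Normal → B ≤ R → (∀ a ∈ A, ∀ g, ⁅a, g⁆ ∈ R) → A ≤ R) : A ≤ B := by
  have key : ∀ n, A ≤ B ⊔ (⊤ : Subgroup G).lowerCentralSeries n := by
    intro n
    induction n with
    | zero => simp
    | succ n ih =>
      refine h _ inferInstance le_sup_left fun a ha g => ?_
      have ha' := ih ha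
      rw [Subgroup.sup_eq_closure] at ha'
      refine commutatorElement_mem_of_mem_closure ?_ ha' g
      rintro x (hx | hx) g
      · exact Subgroup.mem_sup_left
          (Subgroup.commutator_le_left B ⊤ (Subgroup.commutator_mem_commutator hx trivial))
      · exact Subgroup.mem_sup_right (Subgroup.commutator_mem_commutator hx trivial)
  obtain ⟨n, hn⟩ := Subgroup.nilpotent_iff_lowerCentralSeries.1 ‹Group.IsNilpotent G›
  simpa [hn] using key n

/-- The commutators of a subgroup of the square series lie two steps below it. -/
theorem commutatorElement_mem_squareSeries [Group.IsNilpotent G]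
    (hG : commutator G ≤ squareSeries G 2) (k : ℕ) :
    ∀ x ∈ squareSeries G k, ∀ g, ⁅x, g⁆ ∈ squareSeries G (k + 2) := by
  induction k with
  | zero => exact fun x _ g => hG (Subgroup.commutator_mem_commutator trivial trivial)
  | succ k ih =>
    suffices h : ⁅squareSeries G (k + 1), (⊤ : Subgroup G)⁆ ≤ squareSeries G (k + 3) from
      fun x hx g => h (Subgroup.commutator_mem_commutator hx trivial)
    refine le_of_forall_normal_commutator_le fun R hR hle hcomm => ?_
    have h1 : ∀ a ∈ squareSeries G (k + 1), ∀ g h, ⁅⁅a, g⁆, h⁆ ∈ R := fun a ha g h =>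
      hcomm _ (Subgroup.commutator_mem_commutator ha trivial) h
    have hsq : ∀ a ∈ squareSeries G k, ∀ g, ⁅a, g⁆ ^ 2 ∈ R := fun a ha g =>
      hle (sq_mem_squareSeries (ih a ha g))
    -- Modulo R, [Gₖ₊₁, G] is central, so [a², g] ≡ [a, g]². This first makes Gₖ₊₂ central, which
    -- yields the same congruence for a in Gₖ.
    have h2 : ∀ a ∈ squareSeries G (k + 2), ∀ g, ⁅a, g⁆ ∈ R := by
      intro a ha
      refine commutatorElement_mem_of_mem_closure ?_ ha
      rintro _ ⟨a, ha, rfl⟩ g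
      rw [commutatorElement_sq_left, ← commutatorElement_inv]
      exact mul_mem (inv_mem (h1 a ha g a)) (hsq a (squareSeries_antitone k.le_succ ha) g)
    rw [Subgroup.commutator_le]
    intro a ha g _
    refine commutatorElement_mem_of_mem_closure ?_ ha g
    rintro _ ⟨a, ha, rfl⟩ g
    rw [commutatorElement_sq_left, ← commutatorElement_inv]
    exact mul_mem (inv_mem (h2 _ (ih a ha g) a)) (hsq a ha g)

/-! ### Termination of the series and square roots -/

theorem squareSeries_succ_lt [Finite G] (hG : IsPGroup 2 G) {k : ℕ} (hk : squareSeries G k ≠ ⊥) :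
    squareSeries G (k + 1) < squareSeries G k := by
  refine lt_of_le_of_ne (squareSeries_antitone k.le_succ) fun heq => ?_
  set L := squareSeries G k with hL
  have : Fact (Nat.Prime 2) := ⟨Nat.prime_two⟩
  obtain ⟨n, hn⟩ := (hG.to_subgroup L).exists_card_eq
  cases n with
  | zero => exact hk (Subgroup.card_eq_one.1 (by simpa using hn))
  | succ n =>
    obtain ⟨H, hH⟩ := Sylow.exists_subgroup_card_pow_prime (G := L) 2 (n := n)
      (by rw [hn]; exact pow_dvd_pow 2 n.le_succ)
    have hidx : H.index = 2 := by
      have := H.card_mul_index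
      rw [hH, hn, pow_succ] at this
      exact Nat.eq_of_mul_eq_mul_left (by positivity) this
    -- A subgroup of index 2 contains all squares.
    have hle : squareSeries G (k + 1) ≤ H.map L.subtype :=
      squareSeries_succ_le_iff.2 fun x hx =>
        ⟨(⟨x, hx⟩ : L) ^ 2, Subgroup.sq_mem_of_index_two hidx _, rfl⟩
    have htop : H = ⊤ := by
      refine eq_top_iff.2 fun x _ => ?_
      obtain ⟨y, hy, hxy⟩ := hle (heq.ge x.2)
      rwa [← Subtype.ext hxy]
    simp [htop] at hidx

theorem exists_squareSeries_eq_bot [Finite G] (hG : IsPGroup 2 G) :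
    ∃ N, squareSeries G N = ⊥ := by
  by_contra! h
  exact not_strictAnti_of_wellFoundedLT _
    (strictAnti_nat_of_succ_lt fun k => squareSeries_succ_lt hG (h k))

variable (G) in
/-- The properties of the square series of a powerful `2`-group that the estimates below need. -/
structure IsPowerfulSquareSeries : Prop where
  comm : ∀ k, ∀ x ∈ squareSeries G k, ∀ g, ⁅x, g⁆ ∈ squareSeries G (k + 2)
  eq_bot : ∃ N, squareSeries G N = ⊥

theorem IsPowerfulSquareSeries.exists_sq_mul (h : IsPowerfulSquareSeries G) {k : ℕ} {z : G}
    (hz : z ∈ squareSeries G (k + 1)) :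
    ∃ a ∈ squareSeries G k, ∃ w ∈ squareSeries G (k + 2), z = a ^ 2 * w := by
  have hcomm : ∀ a ∈ squareSeries G k, ∀ g, ⁅a, g⁆ ∈ squareSeries G (k + 2) := h.comm k
  induction hz using Subgroup.closure_induction with
  | mem x hx =>
    obtain ⟨a, ha, rfl⟩ := hx
    exact ⟨a, ha, 1, one_mem _, by simp⟩
  | one => exact ⟨1, one_mem _, 1, one_mem _, by simp⟩
  | mul x y _ _ hx hy =>
    obtain ⟨a, ha, v, hv, rfl⟩ := hx
    obtain ⟨b, hb, w, hw, rfl⟩ := hy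
    refine ⟨a * b, mul_mem ha hb, ((a * b) ^ 2)⁻¹ * (a ^ 2 * v * (b ^ 2 * w)), ?_, by group⟩
    rw [mul_sq_eq_conj_commutatorElement]
    have e : (a * ⁅b, a⁆ * a⁻¹ * (a ^ 2 * b ^ 2))⁻¹ * (a ^ 2 * v * (b ^ 2 * w)) =
        ((a ^ 2 * b ^ 2)⁻¹ * (a * ⁅b, a⁆ * a⁻¹)⁻¹ * ((a ^ 2 * b ^ 2)⁻¹)⁻¹) *
          ((b ^ 2)⁻¹ * v * ((b ^ 2)⁻¹)⁻¹) * w := by group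
    rw [e]
    have hn := squareSeries_normal (G := G) (k + 2)
    exact mul_mem (mul_mem (hn.conj_mem _ (inv_mem (hn.conj_mem _ (hcomm b hb a) _)) _)
      (hn.conj_mem _ hv _)) hw
  | inv x _ hx =>
    obtain ⟨a, ha, v, hv, rfl⟩ := hx
    exact ⟨a⁻¹, inv_mem ha, a ^ 2 * v⁻¹ * (a ^ 2)⁻¹,
      (squareSeries_normal _).conj_mem _ (inv_mem hv) _, by group⟩

/-- Every element of a subgroup of the square series is a square of an element of the previous
one. -/
theorem IsPowerfulSquareSeries.exists_sq (h : IsPowerfulSquareSeries G) {k : ℕ} {z : G}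
    (hz : z ∈ squareSeries G (k + 1)) : ∃ a ∈ squareSeries G k, z = a ^ 2 := by
  -- Successive approximation: a²v² and (av)² differ by a conjugate of [v, a], which lies deeper
  -- than v, so the error w sinks until it is trivial.
  have key : ∀ j, ∃ a ∈ squareSeries G k, ∃ w ∈ squareSeries G (k + j + 2), z = a ^ 2 * w := by
    intro j
    induction j with
    | zero => exact h.exists_sq_mul hz
    | succ j ih =>
      obtain ⟨a, ha, w, hw, rfl⟩ := ih
      obtain ⟨v, hv, w, hw', rfl⟩ := h.exists_sq_mul hw
      refine ⟨a * v, mul_mem ha (squareSeries_antitone (by omega) hv),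
        ((a * v) ^ 2)⁻¹ * (a ^ 2 * (v ^ 2 * w)), ?_, by group⟩
      rw [mul_sq_eq_conj_commutatorElement]
      have e : (a * ⁅v, a⁆ * a⁻¹ * (a ^ 2 * v ^ 2))⁻¹ * (a ^ 2 * (v ^ 2 * w)) =
          ((a ^ 2 * v ^ 2)⁻¹ * (a * ⁅v, a⁆ * a⁻¹)⁻¹ * ((a ^ 2 * v ^ 2)⁻¹)⁻¹) * w := by group
      rw [e]
      have hn := squareSeries_normal (G := G) (k + (j + 1) + 2)
      exact mul_mem (hn.conj_mem _ (inv_mem (hn.conj_mem _ (h.comm (k + j + 1) v hv a) _)) _) hw'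
  obtain ⟨N, hN⟩ := h.eq_bot
  obtain ⟨a, ha, w, hw, rfl⟩ := key N
  have hw1 : w ∈ squareSeries G N := squareSeries_antitone (by omega) hw
  rw [hN, Subgroup.mem_bot] at hw1
  exact ⟨a, ha, by simp [hw1]⟩

theorem pow_two_pow_eq_one_of_le {x : G} {i j : ℕ} (hij : i ≤ j) (hx : x ^ 2 ^ i = 1) :
    x ^ 2 ^ j = 1 :=
  orderOf_dvd_iff_pow_eq_one.1 ((orderOf_dvd_iff_pow_eq_one.2 hx).trans (pow_dvd_pow 2 hij))

theorem sq_pow_two_pow (x : G) (i : ℕ) : (x ^ 2) ^ 2 ^ i = x ^ 2 ^ (i + 1) := by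
  rw [← pow_mul, pow_succ, mul_comm]

/-! ### Orders of commutators -/

/-- The assertion that the elements of order dividing `2 ^ i` in `Gₘ₊₁` are closed under
multiplication, and that commutators with elements of order dividing `2 ^ i` in `Gₘ` have order
dividing `2 ^ i`. -/
structure OmegaControl (G : Type*) [Group G] (m : ℕ) : Prop where
  mul : ∀ i : ℕ, ∀ x ∈ squareSeries G (m + 1), ∀ y ∈ squareSeries G (m + 1),
    x ^ 2 ^ i = 1 → y ^ 2 ^ i = 1 → (x * y) ^ 2 ^ i = 1
  comm : ∀ i : ℕ, ∀ x ∈ squareSeries G m, ∀ g : G, x ^ 2 ^ i = 1 → ⁅x, g⁆ ^ 2 ^ i = 1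

/-- Commutators of `2`-power torsion elements of `Gₘ`, where one of them lies in `Gₘ₊ᵦ`. -/
def CommutatorTorsion (G : Type*) [Group G] (m i b : ℕ) : Prop :=
  ∀ d ∈ squareSeries G (m + b), ∀ n ∈ squareSeries G m,
    d ^ 2 ^ (i + 1) = 1 → n ^ 2 ^ (i + b) = 1 → ⁅d, n⁆ ^ 2 ^ i = 1

theorem inv_pow_eq_one_of_pow_eq_one {x : G} {n : ℕ} (hx : x ^ n = 1) : x⁻¹ ^ n = 1 := by
  rw [inv_pow, hx, inv_one]

/-- The commutator of a square `h ^ 2`, bounded through `q = ⁅h, n⁆` and `⁅q, h⁆`. -/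
theorem OmegaControl.sq_comm_pow (h : IsPowerfulSquareSeries G) {m i : ℕ}
    (hc : OmegaControl G (m + 1)) {x g : G} (hx : x ∈ squareSeries G m)
    (h1 : ⁅x, g⁆ ^ 2 ^ (i + 1) = 1) (h2 : ⁅⁅x, g⁆, x⁆ ^ 2 ^ i = 1) : ⁅x ^ 2, g⁆ ^ 2 ^ i = 1 := by
  have hq := h.comm m x hx g
  rw [commutatorElement_sq_left, ← commutatorElement_inv]
  refine hc.mul i _ (inv_mem (squareSeries_antitone (by omega) (h.comm _ _ hq x))) _
    (squareSeries_antitone (by omega) (sq_mem_squareSeries hq))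
    (inv_pow_eq_one_of_pow_eq_one h2) ?_
  rwa [sq_pow_two_pow]

/-- Writing d = x² trades level i for i + 1 on [x, n], while [[x, n], x] falls under the same claim
with larger b. -/
theorem commutatorTorsion_of_two_le (h : IsPowerfulSquareSeries G) {m i : ℕ}
    (hc : OmegaControl G (m + 1)) (hU : ∀ b, 1 ≤ b → CommutatorTorsion G m (i + 1) b) :
    ∀ b, 2 ≤ b → CommutatorTorsion G m i b := by
  obtain ⟨N, hN⟩ := h.eq_bot
  suffices H : ∀ s b, N ≤ b + s → 2 ≤ b → CommutatorTorsion G m i b from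
    fun b hb => H N b (by omega) hb
  intro s
  induction s with
  | zero =>
    intro b hb _ d hd n _ _ _
    have hd1 : d ∈ squareSeries G N := squareSeries_antitone (by omega) hd
    rw [hN, Subgroup.mem_bot] at hd1
    simp [hd1]
  | succ s ih =>
    intro b hb hb2 d hd n hn hdi hni
    obtain ⟨b, rfl⟩ : ∃ c, b = c + 1 := ⟨b - 1, by omega⟩
    obtain ⟨x, hx, rfl⟩ := h.exists_sq (k := m + b) hd
    rw [sq_pow_two_pow] at hdi
    have hxm : x ∈ squareSeries G m := squareSeries_antitone (by omega) hx
    have hq : ⁅x, n⁆ ^ 2 ^ (i + 1) = 1 :=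
      hU b (by omega) x hx n hn hdi (by rwa [show i + 1 + b = i + (b + 1) by ring])
    exact hc.sq_comm_pow h hxm hq (ih (b + 2) (by omega) (by omega) _
      (h.comm (m + b) x hx n) x hxm hq (pow_two_pow_eq_one_of_le (by omega) hdi))

theorem comm_pow_eq_one_of_commutatorTorsion (h : IsPowerfulSquareSeries G) {m i : ℕ}
    (hc : OmegaControl G (m + 1)) (hU : CommutatorTorsion G m i 3)
    (hQ : ∀ x ∈ squareSeries G m, ∀ g : G, x ^ 2 ^ (i + 2) = 1 → ⁅x, g⁆ ^ 2 ^ (i + 2) = 1) :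
    ∀ x ∈ squareSeries G m, ∀ g : G, x ^ 2 ^ (i + 1) = 1 → ⁅x, g⁆ ^ 2 ^ (i + 1) = 1 := by
  intro x hx g hxi
  obtain ⟨N, hN⟩ := h.eq_bot
  suffices H : ∀ s k, N ≤ k + s → ∀ g ∈ squareSeries G k, ⁅x, g⁆ ^ 2 ^ (i + 1) = 1 from
    H N 0 (by omega) g trivial
  clear g
  intro s
  induction s with
  | zero =>
    intro k hk g hg
    have hg1 : g ∈ squareSeries G N := squareSeries_antitone (by omega) hg
    rw [hN, Subgroup.mem_bot] at hg1
    simp [hg1]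
  | succ s ih =>
    intro k hk g hg
    have hci : ⁅x, g⁆ ^ 2 ^ (i + 2) = 1 := hQ x hx g (pow_two_pow_eq_one_of_le (by omega) hxi)
    have hcm := h.comm m x hx g
    have hck : ⁅x, g⁆ ∈ squareSeries G (max m k + 2) := by
      rcases le_total m k with hmk | hmk
      · rw [max_eq_right hmk, ← commutatorElement_inv]
        exact inv_mem (h.comm k g hg x)
      · rwa [max_eq_left hmk]
    -- The root n of [x, g] is deeper than g, so the induction bounds [n, x], which lies in Gₘ₊₃;
    -- hence b = 3.
    obtain ⟨n, hn, hcn⟩ := h.exists_sq hck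
    have hnm : n ∈ squareSeries G (m + 1) := squareSeries_antitone (by omega) hn
    have hnm' : n ∈ squareSeries G m := squareSeries_antitone (by omega) hn
    have hd : ⁅n, x⁆ ^ 2 ^ (i + 1) = 1 := by
      rw [← commutatorElement_inv]
      exact inv_pow_eq_one_of_pow_eq_one
        (ih (k + 1) (by omega) n (squareSeries_antitone (by omega) hn))
    have hni : n ^ 2 ^ (i + 3) = 1 := by rw [← sq_pow_two_pow, ← hcn, hci]
    have hcx : ⁅⁅x, g⁆, x⁆ ^ 2 ^ i = 1 := by
      rw [hcn]
      exact hc.sq_comm_pow h hnm' hd (hU _ (h.comm (m + 1) n hnm x) n hnm' hd hni)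
    have hx2 : ⁅x ^ 2, g⁆ ^ 2 ^ i = 1 :=
      hc.comm i _ (sq_mem_squareSeries hx) g (by rwa [sq_pow_two_pow])
    rw [← sq_pow_two_pow]
    have e : ⁅x, g⁆ ^ 2 = ⁅⁅x, g⁆, x⁆ * ⁅x ^ 2, g⁆ := by
      rw [commutatorElement_sq_left, ← commutatorElement_inv x ⁅x, g⁆, inv_mul_cancel_left]
    rw [e]
    exact hc.mul i _ (squareSeries_antitone (by omega) (h.comm _ _ hcm x)) _
      (squareSeries_antitone (by omega) (h.comm _ _ (sq_mem_squareSeries hx) g)) hcx hx2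

theorem commutatorTorsion_one (h : IsPowerfulSquareSeries G) {m i : ℕ}
    (hc : OmegaControl G (m + 1)) (hU : CommutatorTorsion G m i 2)
    (hQ : ∀ x ∈ squareSeries G m, ∀ g : G, x ^ 2 ^ (i + 1) = 1 → ⁅x, g⁆ ^ 2 ^ (i + 1) = 1) :
    CommutatorTorsion G m i 1 := by
  intro d hd n hn hdi hni
  obtain ⟨x, hx, rfl⟩ := h.exists_sq hd
  rw [sq_pow_two_pow] at hdi
  have hq : ⁅x, n⁆ ^ 2 ^ (i + 1) = 1 := by
    rw [← commutatorElement_inv]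
    exact inv_pow_eq_one_of_pow_eq_one (hQ n hn x hni)
  exact hc.sq_comm_pow h hx hq (hU _ (h.comm m x hx n) x hx hq hdi)

theorem omegaControl_of_succ (h : IsPowerfulSquareSeries G) {E m : ℕ} (hE : ∀ g : G, g ^ 2 ^ E = 1)
    (hc : OmegaControl G (m + 1)) : OmegaControl G m := by
  have key : ∀ s i, E ≤ i + s → (∀ b, 1 ≤ b → CommutatorTorsion G m i b) ∧
      ∀ x ∈ squareSeries G m, ∀ g : G, x ^ 2 ^ (i + 1) = 1 → ⁅x, g⁆ ^ 2 ^ (i + 1) = 1 := by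
    intro s
    induction s with
    | zero =>
      exact fun i hi => ⟨fun b _ d _ n _ _ _ => pow_two_pow_eq_one_of_le hi (hE _),
        fun x _ g _ => pow_two_pow_eq_one_of_le (by omega) (hE _)⟩
    | succ s ih =>
      intro i hi
      obtain ⟨hU, hQ⟩ := ih (i + 1) (by omega)
      have hU2 := commutatorTorsion_of_two_le h hc hU
      have hQ1 := comm_pow_eq_one_of_commutatorTorsion h hc (hU2 3 (by omega)) hQ
      refine ⟨fun b hb => ?_, hQ1⟩
      rcases hb.eq_or_lt with rfl | hb
      · exact commutatorTorsion_one h hc (hU2 2 le_rfl) hQ1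
      · exact hU2 b hb
  refine ⟨fun i x hx y hy hxi hyi => ?_, fun i x hx g hxi => ?_⟩
  · cases i with
    | zero => simp_all
    | succ i =>
      have hu : ⁅y, x⁆ ^ 2 ^ i = 1 := (key E i (by omega)).1 1 le_rfl y hy x
        (squareSeries_antitone m.le_succ hx) hyi hxi
      have hn := squareSeries_normal (G := G) (m + 2)
      have hx2 := sq_mem_squareSeries hx
      have hy2 := sq_mem_squareSeries hy
      rw [← sq_pow_two_pow, mul_sq_eq_conj_commutatorElement]
      refine hc.mul i _ (hn.conj_mem _ (squareSeries_antitone (by omega) (h.comm _ y hy x)) _) _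
        (mul_mem hx2 hy2) ?_ (hc.mul i _ hx2 _ hy2 ?_ ?_)
      · rw [conj_pow, hu, mul_one, mul_inv_cancel]
      · rwa [sq_pow_two_pow]
      · rwa [sq_pow_two_pow]
  · cases i with
    | zero => simp_all
    | succ i => exact (key E i (by omega)).2 x hx g hxi

theorem omegaControl (h : IsPowerfulSquareSeries G) {E : ℕ} (hE : ∀ g : G, g ^ 2 ^ E = 1) (m : ℕ) :
    OmegaControl G m := by
  obtain ⟨N, hN⟩ := h.eq_bot
  suffices H : ∀ s m, N ≤ m + s → OmegaControl G m from H N m (by omega)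
  intro s
  induction s with
  | zero =>
    intro m hm
    have hbot : ∀ k, m ≤ k → ∀ x ∈ squareSeries G k, x = 1 := fun k hk x hx => by
      have hx1 : x ∈ squareSeries G N := squareSeries_antitone (by omega) hx
      rwa [hN, Subgroup.mem_bot] at hx1
    refine ⟨fun i x hx y hy _ _ => ?_, fun i x hx g _ => ?_⟩
    · simp [hbot _ m.le_succ x hx, hbot _ m.le_succ y hy]
    · simp [hbot _ le_rfl x hx]
  | succ s ih => exact fun m hm => omegaControl_of_succ h hE (ih (m + 1) (by omega))

/-- The elements of `G₁` of order dividing `2 ^ i` form a subgroup. -/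
def OmegaControl.torsion (hc : OmegaControl G 0) (i : ℕ) : Subgroup G where
  carrier := {x | x ∈ squareSeries G 1 ∧ x ^ 2 ^ i = 1}
  mul_mem' {x y} hx hy := ⟨mul_mem hx.1 hy.1, hc.mul i x hx.1 y hy.1 hx.2 hy.2⟩
  one_mem' := ⟨one_mem _, one_pow _⟩
  inv_mem' hx := ⟨inv_mem hx.1, inv_pow_eq_one_of_pow_eq_one hx.2⟩

theorem OmegaControl.torsion_normal (hc : OmegaControl G 0) (i : ℕ) : (hc.torsion i).Normal :=
  ⟨fun x hx g => ⟨(squareSeries_normal 1).conj_mem x hx.1 g, by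
    rw [conj_pow, hx.2, mul_one, mul_inv_cancel]⟩⟩

end SquareSeries

/-! ### Application to powerful 2-groups -/

theorem IsPGroup.exists_forall_pow_eq_one {p : ℕ} [Fact p.Prime] {G : Type*} [Group G] [Finite G]
    (hG : IsPGroup p G) : ∃ n, ∀ g : G, g ^ p ^ n = 1 := by
  obtain ⟨n, hn⟩ := hG.exists_card_eq
  exact ⟨n, fun g => by rw [← hn]; exact pow_card_eq_one'⟩

theorem IsPGroup.pow_eq_one_of_mem_omegaSet {p : ℕ} [hp : Fact p.Prime] {G : Type*} [Group G]
    (hG : IsPGroup p G) {i : ℕ} {x : G} (hx : x ∈ omegaSet p G i) : x ^ p ^ i = 1 := by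
  obtain ⟨k, hk⟩ := IsPGroup.iff_orderOf.1 hG x
  have hle : p ^ k ≤ p ^ i := hk ▸ hx.2
  rw [← orderOf_dvd_iff_pow_eq_one, hk]
  exact pow_dvd_pow p ((Nat.pow_le_pow_iff_right hp.out.one_lt).1 hle)

theorem IsPowerfulPGroup.isPowerfulSquareSeries {G : Type*} [Group G]
    (hG : IsPowerfulPGroup 2 G) : IsPowerfulSquareSeries G := by
  have := hG.finite
  have : Fact (Nat.Prime 2) := ⟨Nat.prime_two⟩
  have : Group.IsNilpotent G := hG.isPGroup.isNilpotent
  refine ⟨commutatorElement_mem_squareSeries (hG.commutator_le.trans ?_),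
    exists_squareSeries_eq_bot hG.isPGroup⟩
  rw [if_pos rfl, powerSubgroup, Subgroup.closure_le]
  rintro _ ⟨g, rfl⟩
  rw [show g ^ 4 = (g ^ 2) ^ 2 by rw [← pow_mul]]
  exact sq_mem_squareSeries (sq_mem_squareSeries trivial)

theorem Monoid.exponent_subgroup_le {G : Type*} [Group G] {H : Subgroup G} {n : ℕ} (hn : 0 < n)
    (h : ∀ x ∈ H, x ^ n = 1) : Monoid.exponent H ≤ n :=
  Monoid.exponent_min' n hn fun x => Subtype.ext (h x x.2)

theorem mainTheorem2 {G : Type*} [Group G] (hG : IsPowerfulPGroup 2 G) (i : ℕ) :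
    Monoid.exponent (⁅omega 2 G i, (⊤ : Subgroup G)⁆ : Subgroup G) ≤ 2 ^ i ∧
      Monoid.exponent (omega 2 G i) ≤ 2 ^ (i + 1) := by
  have := hG.finite
  have : Fact (Nat.Prime 2) := ⟨Nat.prime_two⟩
  have h := hG.isPowerfulSquareSeries
  obtain ⟨E, hE⟩ := hG.isPGroup.exists_forall_pow_eq_one
  have hc := omegaControl h hE 0
  have := hc.torsion_normal i
  have hcomm : ∀ z ∈ omega 2 G i, ∀ g, ⁅z, g⁆ ∈ hc.torsion i := fun z hz =>
    commutatorElement_mem_of_mem_closure (M := hc.torsion i) (fun x hx g =>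
      ⟨squareSeries_antitone one_le_two (h.comm 0 x trivial g),
        hc.comm i x trivial g (hG.isPGroup.pow_eq_one_of_mem_omegaSet hx)⟩) hz
  have hsq : ∀ z ∈ omega 2 G i, z ^ 2 ∈ hc.torsion i := by
    intro z hz
    induction hz using Subgroup.closure_induction with
    | mem x hx =>
      refine ⟨sq_mem_squareSeries trivial, ?_⟩
      rw [sq_pow_two_pow]
      exact pow_two_pow_eq_one_of_le i.le_succ (hG.isPGroup.pow_eq_one_of_mem_omegaSet hx)
    | one => simp
    | mul x y _ hy hx2 hy2 =>
      rw [mul_sq_eq_conj_commutatorElement]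
      exact mul_mem ((hc.torsion_normal i).conj_mem _ (hcomm y hy x) _) (mul_mem hx2 hy2)
    | inv x _ hx => simpa using hx
  refine ⟨Monoid.exponent_subgroup_le (by positivity) fun x hx => ?_,
    Monoid.exponent_subgroup_le (by positivity) fun x hx => ?_⟩
  · have hle : ⁅omega 2 G i, (⊤ : Subgroup G)⁆ ≤ hc.torsion i :=
      Subgroup.commutator_le.2 fun z hz g _ => hcomm z hz g
    exact (hle hx).2
  · rw [← sq_pow_two_pow]
    exact (hsq x hx).2
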